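/- Consider $n$ identical disc-shaped robots of radius $r>0$ in the plane, with states $(x,y,\theta)\in\mathbb{R}^2\times S^1$ and kinematics $\dot x=v\cos\theta$, $\dot y=v\sin\theta$, $\dot\theta=\omega$, where $v=\tfrac12(v_l+v_r)$, $\omega=(v_r-v_l)/d_{iw}$, $v_l,v_r$ are the speeds of the left and right wheel and $d_{iw}>0$ is the distance between the wheels. Each robot has a binary sensor that tells whether the infinite ray from its center in direction $\theta$ meets the disc of another robot. A bimodal controller prescribes one pair of constant wheel speeds, in units of the maximal wheel speed $v_{\max}>0$ and in $[-1,1]^2$, used when no robot is in sight (mode A) and another one used when a robot is in sight (mode B); all robots use the same controller. Discs may touch but not overlap. There is no slippage and robots cannot push each other: at almost every time a robot executes a fraction $c\in[0,1]$ of its commanded motion $(v,\omega)$, with $c=1$ unless it touches a robot into which its commanded velocity points. (So two robots that touch and drive into each other stand still.) A state is aggregated if the closed discs of radius $r+\rho$ about the centers have a connected union, where $\rho\ge 0$ is fixed. An initial state is nonaggregating if a trajectory starting from it exists for all times $t\ge0$ and no such trajectory is ever in an aggregated state. Let mode A of the controller be circular backwards motion, that is, with wheel speeds $(-a,-b)$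 where $a,b\in(0,1]$ and $a\ne b$, on a circle of radius $R=|v/\omega|>1.707\,r$, and let mode B be arbitrary. Let $n\ge 4$ be even. Then the probability of nonaggregation is strictly positive if the initial state is chosen uniformly at random from a large enough workspace: there is $L>0$, depending on the above data, such that for every measurable set $W\subseteq\mathbb{R}^2$ of finite area that contains a disc of radius $L$, the set of nonaggregating initial states contains a measurable set of strictly positive probability under the uniform distribution on the states with all centers in $W$ and pairwise distances between centers at least $2r$. -/

import Mathlib

open MeasureTheory Set
open scoped ENNReal

noncomputable section

namespace Swarm

/-- Orientations are angles modulo `2 * π`; this makes arc length available on them. -/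
instance twoPiPos : Fact (0 < 2 * Real.pi) := ⟨Real.two_pi_pos⟩

/-- The physical data common to all robots: the radius `r` of the disc, the distance `axle` between
the two wheels, and the maximal wheel speed `vmax`. -/
structure Body where
  r : ℝ
  axle : ℝ
  vmax : ℝ
  r_pos : 0 < r
  axle_pos : 0 < axle
  vmax_pos : 0 < vmax

/-- Normalized speeds of the left and the right wheel. -/
structure Wheels where
  left : ℝ
  right : ℝ
  left_mem : left ∈ Icc (-1 : ℝ) 1
  right_mem : right ∈ Icc (-1 : ℝ) 1

/-- A bimodal controller: the wheel speeds used when no other robot is in sight (mode A), and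
those used when another robot is in sight (mode B). -/
structure Controller where
  unseen : Wheels
  seen : Wheels

/-- Circular backwards motion: wheel speeds `(-a, -b)` with `a, b ∈ (0, 1]` and `a ≠ b`. -/
def Wheels.IsCircularBackwards (w : Wheels) : Prop :=
  w.left < 0 ∧ w.right < 0 ∧ w.left ≠ w.right

/-- The tangential speed `v = (v_l + v_r) / 2`. -/
def Body.speed (B : Body) (w : Wheels) : ℝ :=
  (B.vmax * w.left + B.vmax * w.right) / 2

/-- The angular velocity `ω = (v_r - v_l) / axle`. -/
def Body.turnRate (B : Body) (w : Wheels) : ℝ :=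
  (B.vmax * w.right - B.vmax * w.left) / B.axle

/-- The radius `|v / ω|` of the circle on which a robot moves when its wheel speeds are kept
constant and different from each other. -/
def Body.turnRadius (B : Body) (w : Wheels) : ℝ :=
  |B.speed w / B.turnRate w|

/-- The state of a robot: its center, in the plane `ℝ² = ℂ`, and its orientation in `S¹`. -/
abbrev Pose : Type := ℂ × AddCircle (2 * Real.pi)

/-- The state of a system of `n` robots. -/
abbrev State (n : ℕ) : Type := Fin n → Pose

/-- The unit vector `cos θ + i sin θ` in the direction of the orientation `θ`. -/
def heading (p : Pose) : ℂ := (AddCircle.toCircle p.2 : ℂ)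

/-- The states in which no two discs of radius `r` overlap (touching is allowed). -/
def freeStates (r : ℝ) (n : ℕ) : Set (State n) :=
  {x | ∀ i j, i ≠ j → 2 * r ≤ dist (x i).1 (x j).1}

/-- The aggregated states: the discs of radius `r + ρ` about the robots form a connected set. -/
def aggregatedStates (r ρ : ℝ) (n : ℕ) : Set (State n) :=
  {x | x ∈ freeStates r n ∧ IsConnected (⋃ i, Metric.closedBall (x i).1 (r + ρ))}

/-- The binary sensor of robot `i`: the infinite ray from its center in the direction of its
orientation meets the disc of another robot. -/
def Sees (r : ℝ) {n : ℕ} (x : State n) (i : Fin n) : Prop :=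
  ∃ j, j ≠ i ∧ ∃ s : ℝ, 0 ≤ s ∧ (x i).1 + s * heading (x i) ∈ Metric.closedBall (x j).1 r

open Classical in
/-- The wheel speeds that the controller commands to robot `i` in the state `x`. -/
def command (B : Body) (u : Controller) {n : ℕ} (x : State n) (i : Fin n) : Wheels :=
  if Sees B.r x i then u.seen else u.unseen

/-- In the state `x`, robot `i` touches another robot and its commanded velocity points into that
robot, that is, has a positive component towards its center. -/
def Obstructed (B : Body) (u : Controller) {n : ℕ} (x : State n) (i : Fin n) : Prop :=
  ∃ j, j ≠ i ∧ dist (x i).1 (x j).1 = 2 * B.r ∧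
    0 < B.speed (command B u x i) * inner ℝ (heading (x i)) ((x j).1 - (x i).1)

/-- `x` is a trajectory (for times `t ≥ 0`) of the robots from the initial state `x₀`.

The discs never overlap, and for almost every time each robot moves according to
`ẋ = v cos θ`, `ẏ = v sin θ`, `θ̇ = ω`, where the last equation is written as
`d/dt exp (iθ) = i ω exp (iθ)`. There is no slippage and no pushing, so a robot never moves
otherwise than along its own commanded motion, executed at some fraction `c ∈ [0, 1]` of the
commanded wheel speeds; and `c = 1` unless the robot is obstructed by a robot that it is touching.
As discs never overlap, a robot driving into one that stands still, or two robots driving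
into each other, stand still. -/
structure IsTrajectory (B : Body) (u : Controller) {n : ℕ} (x₀ : State n)
    (x : ℝ → State n) : Prop where
  init : x 0 = x₀
  free : ∀ t, 0 ≤ t → x t ∈ freeStates B.r n
  ac_center : ∀ i T, 0 ≤ T → AbsolutelyContinuousOnInterval (fun t => (x t i).1) 0 T
  ac_heading : ∀ i T, 0 ≤ T → AbsolutelyContinuousOnInterval (fun t => heading (x t i)) 0 T
  ode : ∀ᵐ t : ℝ, 0 < t → ∀ i, ∃ c ∈ Icc (0 : ℝ) 1,
    HasDerivAt (fun s => (x s i).1)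
      (((c * B.speed (command B u (x t) i) : ℝ) : ℂ) * heading (x t i)) t ∧
    HasDerivAt (fun s => heading (x s i))
      (((c * B.turnRate (command B u (x t) i) : ℝ) : ℂ) * Complex.I * heading (x t i)) t ∧
    (c ≠ 1 → Obstructed B u (x t) i)

/-- The initial states from which the robots do not aggregate: there is a trajectory for all
times `t ≥ 0`, and no trajectory is ever in an aggregated state. -/
def nonaggregating (B : Body) (ρ : ℝ) (u : Controller) (n : ℕ) : Set (State n) :=
  {x₀ | (∃ x, IsTrajectory B u x₀ x) ∧
    ∀ x, IsTrajectory B u x₀ x → ∀ t, 0 ≤ t → x t ∉ aggregatedStates B.r ρ n}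

/-- The initial states in the workspace `W`: free states with all centers in `W`. -/
def initialStates (r : ℝ) (W : Set ℂ) (n : ℕ) : Set (State n) :=
  {x | x ∈ freeStates r n ∧ ∀ i, (x i).1 ∈ W}

/-- The uniform distribution on the initial states in the workspace `W`, with respect to the product
of the area of the plane and of arc length on `S¹`. -/
def uniformLaw (r : ℝ) (W : Set ℂ) (n : ℕ) : Measure (State n) :=
  ProbabilityTheory.cond volume (initialStates r W n)

end Swarm

end

noncomputable section

namespace Swarm

/-! ### Absolutely continuous functions -/

/-! Place the robots in pairs, back to back with a tiny gap, and stack the pairs far apart. Nobody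
sees anybody, so all robots are in mode A and back into their partners until they jam. With at least
two pairs, the configuration stays disconnected. Small perturbations do not matter, so this happens
on a nonempty open set `backToBack` of initial states, which has positive probability.

Trajectories need not be unique, so every one of them must be confined
(`IsTrajectory.mem_backToBack`). The horizontal separation of two partners is a Lyapunov function:
as long as the state stays in a slightly larger set, both partners only decrease it, and each
robot's speed is at most 10/9 times the rate of decrease, whatever fraction of the command is
executed. Since discs cannot overlap, the total decrease is at most `7 * η`. This bounds the
displacement and, up to the factor |ω / v|, the turning of every robot, so that the larger set is
never left.

Existence is explicit (`isTrajectory_haltingMotion`): each robot follows its circular arc until it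
touches its partner and halts for ever. -/

lemma absolutelyContinuousOnInterval_clm_comp {E F : Type*} [NormedAddCommGroup E]
    [NormedSpace ℝ E] [NormedAddCommGroup F] [NormedSpace ℝ F] {f : ℝ → E} {a b : ℝ}
    (A : E →L[ℝ] F) (hf : AbsolutelyContinuousOnInterval f a b) :
    AbsolutelyContinuousOnInterval (fun t => A (f t)) a b := by
  have h := Filter.Tendsto.const_mul ‖A‖ hf
  rw [mul_zero] at h
  refine squeeze_zero (fun t => Finset.sum_nonneg fun i _ => dist_nonneg) (fun t => ?_) h
  rw [Finset.mul_sum]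
  refine Finset.sum_le_sum fun i _ => ?_
  rw [dist_eq_norm, dist_eq_norm, ← map_sub]
  exact A.le_opNorm _

/-- An absolutely continuous function whose derivative is almost everywhere nonpositive
does not increase. -/
lemma le_of_ae_deriv_nonpos {f : ℝ → ℝ} {T : ℝ} (hT : 0 ≤ T)
    (hf : AbsolutelyContinuousOnInterval f 0 T)
    (hd : ∀ᵐ t : ℝ, 0 < t → t < T → ∃ d ≤ 0, HasDerivAt f d t) : f T ≤ f 0 := by
  have h := hf.integral_deriv_eq_sub
  have h0 : ∫ t in (0 : ℝ)..T, deriv f t ≤ ∫ _ in (0 : ℝ)..T, (0 : ℝ) := by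
    refine intervalIntegral.integral_mono_ae_restrict hT hf.intervalIntegrable_deriv
      (by simp) ?_
    have hne : ∀ᵐ t : ℝ, t ≠ T ∧ t ≠ 0 := by
      have : ({T, 0} : Set ℝ)ᶜ ∈ ae volume :=
        compl_mem_ae_iff.2 (Set.Finite.measure_zero (by simp) _)
      filter_upwards [this] with t ht
      simpa [not_or] using ht
    rw [Filter.EventuallyLE, ae_restrict_iff' measurableSet_Icc]
    filter_upwards [hd, hne] with t ht htne hmem
    obtain ⟨d, hd0, hd⟩ := ht (lt_of_le_of_ne hmem.1 (Ne.symm htne.2))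
      (lt_of_le_of_ne hmem.2 htne.1)
    simpa [hd.deriv] using hd0
  simp only [intervalIntegral.integral_zero] at h0
  linarith

/-- If the speed of `G` is at most `K` times the rate at which `φ` decreases, then the
displacement of `G` is at most `K` times the total decrease of `φ`. -/
lemma norm_sub_le_of_dissipation {E : Type*} [NormedAddCommGroup E] [InnerProductSpace ℝ E]
    {G : ℝ → E} {φ : ℝ → ℝ} {T K : ℝ} (hT : 0 ≤ T)
    (hG : AbsolutelyContinuousOnInterval G 0 T) (hφ : AbsolutelyContinuousOnInterval φ 0 T)
    (hd : ∀ᵐ t : ℝ, 0 < t → t < T →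
      ∃ d e, HasDerivAt G d t ∧ HasDerivAt φ e t ∧ ‖d‖ ≤ -(K * e)) :
    ‖G T - G 0‖ ≤ K * (φ 0 - φ T) := by
  set Δ := G T - G 0 with hΔ
  -- Needed only when the displacement vanishes.
  have h1 : K * φ T ≤ K * φ 0 := by
    refine le_of_ae_deriv_nonpos (f := fun t => K * φ t) hT (hφ.const_mul K) ?_
    filter_upwards [hd] with t ht h0 hT
    obtain ⟨d, e, -, he, hde⟩ := ht h0 hT
    exact ⟨K * e, by linarith [norm_nonneg d], he.const_mul K⟩
  -- Pairing with the fixed vector `Δ` makes the estimate scalar: by Cauchy–Schwarz this function is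
  -- nonincreasing, and comparing its endpoints gives ‖Δ‖² ≤ ‖Δ‖ K (φ 0 - φ T).
  have h2 : inner ℝ Δ (G T) + ‖Δ‖ * (K * φ T) ≤ inner ℝ Δ (G 0) + ‖Δ‖ * (K * φ 0) := by
    refine le_of_ae_deriv_nonpos (f := fun t => inner ℝ Δ (G t) + ‖Δ‖ * (K * φ t)) hT
      ((absolutelyContinuousOnInterval_clm_comp (innerSL ℝ Δ) hG).add
        ((hφ.const_mul K).const_mul ‖Δ‖)) ?_
    filter_upwards [hd] with t ht h0 hT
    obtain ⟨d, e, hG', he, hde⟩ := ht h0 hT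
    refine ⟨inner ℝ Δ d + ‖Δ‖ * (K * e), ?_, ?_⟩
    · nlinarith [real_inner_le_norm Δ d, norm_nonneg Δ]
    · exact ((innerSL ℝ Δ).hasFDerivAt.comp_hasDerivAt t hG').add
        ((he.const_mul K).const_mul ‖Δ‖)
  have h3 : inner ℝ Δ (G T) - inner ℝ Δ (G 0) = ‖Δ‖ * ‖Δ‖ := by
    rw [← inner_sub_right, ← hΔ, real_inner_self_eq_norm_mul_norm]
  rcases (norm_nonneg Δ).eq_or_lt with h | h
  · rw [← h]; linarith
  · refine le_of_mul_le_mul_left ?_ h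
    linarith

/-! ### Robots standing back to back in pairs -/

/-- The side of its pair on which a robot stands: `1` is right, `-1` is left. -/
def side (i : ℕ) : ℝ := if Even i then 1 else -1

lemma side_eq (i : ℕ) : side i = 1 ∨ side i = -1 := by
  unfold side; split_ifs <;> simp

/-- The robots `2 * k` and `2 * k + 1` are partners. -/
def partner {n : ℕ} (hn : Even n) (i : Fin n) : Fin n :=
  ⟨if Even i.1 then i.1 + 1 else i.1 - 1, by
    have := i.2
    split_ifs with h <;> grind⟩

variable {n : ℕ} {hn : Even n}

lemma partner_partner (i : Fin n) : partner hn (partner hn i) = i := by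
  ext; simp only [partner]; split_ifs <;> grind

lemma partner_ne (i : Fin n) : partner hn i ≠ i := by
  intro h
  have := congrArg Fin.val h
  simp only [partner] at this
  split_ifs at this <;> grind

lemma side_partner (i : Fin n) : side (partner hn i) = -side i := by
  simp only [partner, side]
  split_ifs <;> grind

lemma partner_div_two (i : Fin n) : (partner hn i).1 / 2 = i.1 / 2 := by
  simp only [partner]; split_ifs <;> grind

lemma eq_partner_of_div_two_eq {i j : Fin n} (hij : j ≠ i) (h : j.1 / 2 = i.1 / 2) :
    j = partner hn i := by
  have : j.1 ≠ i.1 := fun h => hij (Fin.ext h)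
  ext; simp only [partner]; split_ifs <;> grind

/-- The robots stand in pairs, about `2 * r + 4 * η` apart; the pairs are stacked
vertically, at distance `D` from each other. -/
def anchor (z : ℂ) (r η D : ℝ) (i : ℕ) : ℂ :=
  ⟨z.re + side i * (r + 2 * η), z.im + ((i / 2 : ℕ) : ℝ) * D⟩

/-- The states in which all centers are `ε`-close to the anchors, and all robots look, up to an error
`κ`, away from their partners. -/
def backToBack (n : ℕ) (z : ℂ) (r η D ε κ : ℝ) : Set (State n) :=
  {x | ∀ i : Fin n, ‖(x i).1 - anchor z r η D i‖ < ε ∧ ‖heading (x i) - (side i : ℂ)‖ < κ}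

variable {z : ℂ} {r η D ε κ : ℝ} {x : State n}

lemma norm_heading (p : Pose) : ‖heading p‖ = 1 := Circle.norm_coe _

lemma continuous_heading : Continuous heading :=
  continuous_subtype_val.comp (AddCircle.continuous_toCircle.comp continuous_snd)

lemma center_coordinates {w : ℂ} {i : ℕ} (h : ‖w - anchor z r η D i‖ ≤ ε) :
    |w.re - z.re - side i * (r + 2 * η)| ≤ ε ∧
      |w.im - z.im - ((i / 2 : ℕ) : ℝ) * D| ≤ ε := by
  constructor
  · refine le_trans (le_of_eq ?_) ((Complex.abs_re_le_norm _).trans h)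
    simp [anchor, sub_sub]
  · refine le_trans (le_of_eq ?_) ((Complex.abs_im_le_norm _).trans h)
    simp [anchor, sub_sub]

lemma heading_coordinates {h : ℂ} {i : ℕ} (hh : ‖h - (side i : ℂ)‖ ≤ κ) :
    1 - κ ≤ side i * h.re ∧ |h.im| ≤ κ := by
  have h1 := (Complex.abs_re_le_norm _).trans hh
  have h2 := (Complex.abs_im_le_norm _).trans hh
  simp only [Complex.sub_re, Complex.ofReal_re, Complex.sub_im, Complex.ofReal_im,
    sub_zero] at h1 h2
  refine ⟨?_, h2⟩
  rw [abs_le] at h1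
  rcases side_eq i with hs | hs <;> rw [hs] at h1 ⊢ <;> linarith

/-- Distinct pairs are at least `D` apart. -/
lemma le_abs_sub_mul {k l : ℕ} (h : k ≠ l) (hD : 0 ≤ D) : D ≤ |(k : ℝ) * D - (l : ℝ) * D| := by
  rw [← sub_mul, abs_mul, abs_of_nonneg hD]
  have : (1 : ℝ) ≤ |(k : ℝ) - l| := by
    exact_mod_cast Int.one_le_abs (sub_ne_zero.2 (Nat.cast_injective.ne h : (k : ℤ) ≠ l))
  nlinarith

lemma two_mul_lt_dist_of_div_two_ne {i j : Fin n} (hη : 0 < η) (hηr : 1000 * η ≤ r)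
    (hD : 10 * r ≤ D) (hx : x ∈ backToBack n z r η D (10 * η) κ) (hij : i.1 / 2 ≠ j.1 / 2) :
    2 * r < dist (x i).1 (x j).1 := by
  have hi := (center_coordinates (hx i).1.le).2
  have hj := (center_coordinates (hx j).1.le).2
  have hk := le_abs_sub_mul hij (by linarith : 0 ≤ D)
  have hd := Complex.abs_im_le_norm ((x i).1 - (x j).1)
  rw [Complex.sub_im] at hd
  rw [dist_eq_norm]
  rw [abs_le] at hi hj hd
  rcases le_abs'.1 hk with hk | hk <;> linarith

/-- The ray gains at least `9 / 10 * s` horizontally, away from the partner, which is almost `2 * r`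
behind. A disc of another pair could be met only for `s ≤ 2 * r`, when the ray has deviated
vertically by at most `s / 10`, far less than `D`. -/
lemma not_sees (hη : 0 < η) (hηr : 1000 * η ≤ r)
    (hD : 10 * r ≤ D) (hx : x ∈ backToBack n z r η D (10 * η) (1 / 10)) (i : Fin n) :
    ¬ Sees r x i := by
  rintro ⟨j, hji, s, hs, hmem⟩
  rw [Metric.mem_closedBall, dist_eq_norm] at hmem
  obtain ⟨hire, hiim⟩ := center_coordinates (hx i).1.le
  obtain ⟨hjre, hjim⟩ := center_coordinates (hx j).1.le
  obtain ⟨hhre, hhim⟩ := heading_coordinates (hx i).2.le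
  have hre := (Complex.abs_re_le_norm _).trans hmem
  have him := (Complex.abs_im_le_norm _).trans hmem
  simp only [Complex.sub_re, Complex.add_re, Complex.mul_re, Complex.ofReal_re,
    Complex.ofReal_im, zero_mul, sub_zero, Complex.sub_im, Complex.add_im, Complex.mul_im,
    add_zero] at hre him
  have hsre : 9 / 10 * s ≤ side i * (s * (heading (x i)).re) := by nlinarith
  have hsim : |s * (heading (x i)).im| ≤ 1 / 10 * s := by
    rw [abs_mul, abs_of_nonneg hs]; nlinarith
  rw [abs_le] at hire hiim hjre hjim hre him hsim
  by_cases hij : j.1 / 2 = i.1 / 2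
  · have hsj : side j = -side i := by
      have := i.2
      have : j.1 ≠ i.1 := fun h => hji (Fin.ext h)
      unfold side
      split_ifs <;> grind
    rw [hsj] at hjre
    rcases side_eq i with hsi | hsi <;> rw [hsi] at hire hjre hsre <;> linarith
  · have hk := le_abs_sub_mul hij (by linarith : 0 ≤ D)
    have hs2 : s ≤ 2 * r := by
      rcases side_eq i with hsi | hsi <;> rcases side_eq j with hsj | hsj <;>
        rw [hsi] at hire hsre <;> rw [hsj] at hjre <;> linarith
    rcases le_abs'.1 hk with hk | hk <;> linarith

lemma command_eq_unseen {B : Body} {u : Controller} (hη : 0 < η) (hηr : 1000 * η ≤ B.r)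
    (hD : 10 * B.r ≤ D) (hx : x ∈ backToBack n z B.r η D (10 * η) (1 / 10)) (i : Fin n) :
    command B u x i = u.unseen :=
  if_neg (not_sees hη hηr hD hx i)

/-- The heights of a connected union form an interval. It contains the heights of robots 0 and 2,
from the two lowest pairs, but not the height halfway between, which is about `5 * (r + ρ)` away
from every center. -/
lemma notMem_aggregatedStates {ρ : ℝ} (hη : 0 < η) (hηr : 1000 * η ≤ r)
    (hρ : 0 ≤ ρ) (hD : D = 10 * (r + ρ)) (h4 : 4 ≤ n)
    (hx : x ∈ backToBack n z r η D (10 * η) κ) : x ∉ aggregatedStates r ρ n := by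
  rintro ⟨-, hconn⟩
  have hcent : ∀ i : Fin n, (x i).1.im ∈
      Complex.im '' ⋃ i, Metric.closedBall (x i).1 (r + ρ) := fun i =>
    ⟨_, mem_iUnion.2 ⟨i, Metric.mem_closedBall_self (by linarith)⟩, rfl⟩
  have hord :=
    (hconn.image Complex.im Complex.continuous_im.continuousOn).isPreconnected.ordConnected
  have h0 := (center_coordinates (hx ⟨0, by omega⟩).1.le).2
  have h2 := (center_coordinates (hx ⟨2, by omega⟩).1.le).2
  simp only [Nat.zero_div, Nat.cast_zero, zero_mul, sub_zero, Nat.div_self two_pos,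
    Nat.cast_one, one_mul] at h0 h2
  rw [abs_le] at h0 h2
  obtain ⟨w, hw, hwim⟩ := hord.out (hcent ⟨0, by omega⟩) (hcent ⟨2, by omega⟩)
    (show z.im + D / 2 ∈ _ from ⟨by linarith, by linarith⟩)
  obtain ⟨j, hj⟩ := mem_iUnion.1 hw
  rw [Metric.mem_closedBall, dist_eq_norm] at hj
  have hj := (Complex.abs_im_le_norm _).trans hj
  have hjim := (center_coordinates (hx j).1.le).2
  rw [Complex.sub_im, hwim] at hj
  rw [abs_le] at hj hjim
  rcases Nat.eq_zero_or_pos (j.1 / 2) with hk | hk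
  · rw [hk, Nat.cast_zero] at hjim
    linarith
  · have : (1 : ℝ) ≤ ((j.1 / 2 : ℕ) : ℝ) := by exact_mod_cast hk
    nlinarith

lemma isOpen_backToBack : IsOpen (backToBack n z r η D ε κ) := by
  have : backToBack n z r η D ε κ = ⋂ i : Fin n, {x | ‖(x i).1 - anchor z r η D i‖ < ε} ∩
      {x | ‖heading (x i) - (side i : ℂ)‖ < κ} := by
    ext x; simp [backToBack]
  rw [this]
  refine isOpen_iInter_of_finite fun i => IsOpen.inter ?_ ?_
  · exact isOpen_lt (by fun_prop) continuous_const
  · exact isOpen_lt ((continuous_heading.comp (continuous_apply i)).sub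
      continuous_const).norm continuous_const

lemma backToBack_nonempty (hε : 0 < ε) (hκ : 0 < κ) : (backToBack n z r η D ε κ).Nonempty := by
  have h : ∀ i : ℕ, ∃ θ : AddCircle (2 * Real.pi), (AddCircle.toCircle θ : ℂ) = (side i : ℂ) := by
    intro i
    rcases side_eq i with hs | hs
    · exact ⟨0, by simp [hs]⟩
    · refine ⟨(Real.pi : ℝ), ?_⟩
      rw [AddCircle.toCircle_apply_mk, div_self Real.two_pi_pos.ne', one_mul, hs,
        Circle.coe_exp, Complex.exp_pi_mul_I]
      simp
  choose θ hθ using h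
  exact ⟨fun i => (anchor z r η D i, θ i), fun i => by simp [heading, hθ, hε, hκ]⟩

lemma backToBack_subset_backToBack {ε' κ' : ℝ} (hε : ε ≤ ε') (hκ : κ ≤ κ') :
    backToBack n z r η D ε κ ⊆ backToBack n z r η D ε' κ' :=
  fun _ hx i => ⟨(hx i).1.trans_le hε, (hx i).2.trans_le hκ⟩

/-- The gap `4 * η` between the anchors of partners outweighs the two position errors, each less
than `η`. -/
lemma backToBack_subset_freeStates (hη : 0 < η) (hηr : 1000 * η ≤ r)
    (hD : 10 * r ≤ D) : backToBack n z r η D η κ ⊆ freeStates r n := by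
  intro x hx i j hij
  by_cases h : i.1 / 2 = j.1 / 2
  · have hi := (center_coordinates (hx i).1.le).1
    have hj := (center_coordinates (hx j).1.le).1
    have hd := Complex.abs_re_le_norm ((x i).1 - (x j).1)
    have hsj : side j = -side i := by
      have : j.1 ≠ i.1 := fun h => hij (Fin.ext h.symm)
      unfold side
      split_ifs <;> grind
    rw [hsj] at hj
    rw [Complex.sub_re] at hd
    rw [dist_eq_norm]
    rw [abs_le] at hi hj hd
    rcases side_eq i with hs | hs <;> rw [hs] at hi hj <;> linarith
  · exact (two_mul_lt_dist_of_div_two_ne hη hηr hD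
      (backToBack_subset_backToBack (by linarith) le_rfl hx) h).le

/-! ### The uniform distribution -/

lemma volume_initialStates_ne_top {W : Set ℂ} (hW : volume W ≠ ∞) :
    volume (initialStates r W n) ≠ ∞ := by
  have hsub : initialStates r W n ⊆ Set.pi univ fun _ => W ×ˢ univ := fun x hx i _ =>
    ⟨hx.2 i, trivial⟩
  refine ne_top_of_le_ne_top ?_ (measure_mono hsub)
  rw [volume_pi_pi]
  refine ENNReal.prod_ne_top fun i _ => ?_
  rw [Measure.volume_eq_prod, Measure.prod_prod]
  exact ENNReal.mul_ne_top hW (measure_ne_top _ _)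

/-- Nonempty open sets have positive volume; finiteness of the total volume keeps the normalizing
factor from being `∞⁻¹ = 0`. -/
lemma uniformLaw_pos {W : Set ℂ} (hW : volume W ≠ ∞) {N : Set (State n)} (hN : IsOpen N)
    (hne : N.Nonempty) (hsub : N ⊆ initialStates r W n) : 0 < uniformLaw r W n N := by
  rw [uniformLaw, ProbabilityTheory.cond, Measure.smul_apply, smul_eq_mul,
    Measure.restrict_apply hN.measurableSet, inter_eq_left.2 hsub]
  exact ENNReal.mul_pos (ENNReal.inv_ne_zero.2 (volume_initialStates_ne_top hW))
    (hN.measure_pos volume hne).ne'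

lemma norm_anchor_sub_le (hr : 0 < r) (hη : 0 < η) (hD : 0 ≤ D) (i : Fin n) :
    ‖anchor z r η D i - z‖ ≤ r + 2 * η + n * D := by
  have h := Complex.norm_le_abs_re_add_abs_im (anchor z r η D i - z)
  have h1 : ((i.1 / 2 : ℕ) : ℝ) ≤ n := by
    exact_mod_cast (Nat.div_le_self _ _).trans i.2.le
  have h2 : |(anchor z r η D i - z).re| = r + 2 * η := by
    rcases side_eq i with hs | hs <;> simp only [anchor, hs, Complex.sub_re]
    · rw [abs_of_pos] <;> linarith
    · rw [abs_of_neg] <;> linarith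
  have h3 : |(anchor z r η D i - z).im| = ((i.1 / 2 : ℕ) : ℝ) * D := by
    simp only [anchor, Complex.sub_im, add_sub_cancel_left]
    exact abs_of_nonneg (by positivity)
  rw [h2, h3] at h
  nlinarith

lemma backToBack_subset_initialStates {W : Set ℂ} {L : ℝ} (hη : 0 < η) (hηr : 1000 * η ≤ r)
    (hD : 10 * r ≤ D) (hL : 2 * r + n * D ≤ L) (hW : Metric.closedBall z L ⊆ W) :
    backToBack n z r η D η κ ⊆ initialStates r W n := by
  refine fun x hx => ⟨backToBack_subset_freeStates hη hηr hD hx, fun i => hW ?_⟩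
  rw [Metric.mem_closedBall, dist_eq_norm]
  have h1 := (hx i).1
  have h2 := norm_anchor_sub_le (z := z) (r := r) (η := η) (D := D) (by linarith) hη
    (by linarith) i
  have h3 := norm_sub_le_norm_sub_add_norm_sub (x i).1 (anchor z r η D i) z
  linarith

variable {B : Body} {u : Controller}

/-! ### Confinement -/

/-- Two robots that stand back to back without overlapping are separated horizontally by
almost `2 * r`. -/
lemma le_horizontal_separation {r : ℝ} {v w : ℂ} {i : Fin n} (hη : 0 < η) (hηr : 1000 * η ≤ r)
    (hv : ‖v - anchor z r η D i‖ ≤ 10 * η)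
    (hw : ‖w - anchor z r η D (partner hn i)‖ ≤ 10 * η) (hvw : 2 * r ≤ dist v w) :
    2 * r - η ≤ side i * (v.re - w.re) := by
  obtain ⟨hv1, hv2⟩ := center_coordinates hv
  obtain ⟨hw1, hw2⟩ := center_coordinates hw
  rw [side_partner] at hw1
  rw [partner_div_two] at hw2
  rw [abs_le] at hv1 hv2 hw1 hw2
  have hsq : (2 * r) ^ 2 ≤ (v.re - w.re) ^ 2 + (v.im - w.im) ^ 2 := by
    have h := pow_le_pow_left₀ (by linarith) hvw 2
    rwa [dist_eq_norm, Complex.sq_norm, Complex.normSq_apply, ← sq, ← sq, Complex.sub_re,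
      Complex.sub_im] at h
  -- The vertical offset enters only quadratically: `400 * η ^ 2` is less than the gain of about `4
  -- * r * η` from replacing `2 * r` by `2 * r - η`.
  have him : (v.im - w.im) ^ 2 ≤ (20 * η) ^ 2 := sq_le_sq' (by linarith) (by linarith)
  by_contra! hlt
  have hre : (v.re - w.re) ^ 2 ≤ (2 * r - η) ^ 2 := by
    rcases side_eq i with hs | hs <;> rw [hs] at hv1 hw1 hlt <;>
      exact sq_le_sq' (by linarith) (by linarith)
  nlinarith

lemma norm_sub_le_of_closure {f : ℝ → ℂ} {c : ℂ} {T K : ℝ} (hT : 0 < T)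
    (hf : ContinuousOn f (Icc 0 T)) (h : ∀ s ∈ Ico 0 T, ‖f s - c‖ ≤ K) : ‖f T - c‖ ≤ K := by
  have hcl : T ∈ closure (Ico 0 T) := by
    rw [closure_Ico hT.ne]; exact right_mem_Icc.2 hT.le
  exact ContinuousWithinAt.closure_le hcl
    ((((hf.sub continuousOn_const).norm) T (right_mem_Icc.2 hT.le)).mono Ico_subset_Icc_self)
    continuousWithinAt_const h

/-- The bootstrap step: tolerances `10 * η` and `1 / 10` before time `T` imply strictly better ones
at `T`, through the decrease of the separation `φ` of the partners. -/
lemma mem_backToBack_of_forall_before {x₀ : State n} {x : ℝ → State n} (hn : Even n) (hη : 0 < η)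
    (hηr : 1000 * η ≤ B.r) (hη1 : 1000 * η ≤ 1) (hv : B.speed u.unseen < 0)
    (hηw : 1000 * (|B.turnRate u.unseen| * η) ≤ -B.speed u.unseen) (hD : 10 * B.r ≤ D)
    (hx₀ : x₀ ∈ backToBack n z B.r η D η η) (hx : IsTrajectory B u x₀ x) {T : ℝ} (hT : 0 < T)
    (hbefore : ∀ s ∈ Ico 0 T, x s ∈ backToBack n z B.r η D (10 * η) (1 / 10)) :
    x T ∈ backToBack n z B.r η D (10 * η) (1 / 10) := by
  set V := -B.speed u.unseen with hV
  have hVpos : 0 < V := by linarith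
  intro i
  set j := partner hn i with hj
  set φ : ℝ → ℝ := fun t => side i * ((x t i).1.re - (x t j).1.re) with hφ
  have hac := hx.ac_center
  have hφac : AbsolutelyContinuousOnInterval φ 0 T :=
    ((absolutelyContinuousOnInterval_clm_comp Complex.reCLM (hac i T hT.le)).sub
      (absolutelyContinuousOnInterval_clm_comp Complex.reCLM (hac j T hT.le))).const_mul _
  have hcont : ∀ k, ContinuousOn (fun t => (x t k).1) (Icc 0 T) := fun k => by
    simpa [uIcc_of_le hT.le] using (hac k T hT.le).continuousOn
  -- Membership at `T` itself is not yet known, so the position bounds are carried to `T` by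
  -- continuity.
  have hφT : 2 * B.r - η ≤ φ T := by
    refine le_horizontal_separation (hn := hn) (z := z) (D := D) hη hηr ?_ ?_
      (hx.free T hT.le i j (partner_ne i).symm)
    · exact norm_sub_le_of_closure hT (hcont i) fun s hs => (hbefore s hs i).1.le
    · exact norm_sub_le_of_closure hT (hcont j) fun s hs => (hbefore s hs j).1.le
  have hφ0 : φ 0 ≤ 2 * B.r + 6 * η := by
    have hi := (center_coordinates (hx₀ i).1.le).1
    have hj' := (center_coordinates (hx₀ j).1.le).1
    rw [hj, side_partner, ← hj] at hj'
    simp only [hφ, hx.init]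
    rw [abs_le] at hi hj'
    rcases side_eq i with hs | hs <;> rw [hs] at hi hj' ⊢ <;> linarith
  -- Robot `i` alone decreases `φ` at rate at least 9/10 of its speed `V * c`. The partner's
  -- contribution has the same sign and is dropped, so its fraction `c'` is irrelevant.
  have key : ∀ᵐ t : ℝ, 0 < t → t < T → ∃ c ≥ (0 : ℝ), ∃ e : ℝ,
      HasDerivAt (fun s => (x s i).1)
        (((c * B.speed u.unseen : ℝ) : ℂ) * heading (x t i)) t ∧
      HasDerivAt (fun s => heading (x s i))
        (((c * B.turnRate u.unseen : ℝ) : ℂ) * Complex.I * heading (x t i)) t ∧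
      HasDerivAt φ e t ∧ V * c ≤ -(10 / 9 * e) := by
    filter_upwards [hx.ode] with t ht h0 hTt
    have hmem := hbefore t ⟨h0.le, hTt⟩
    obtain ⟨c, hc, hci, hhi, -⟩ := ht h0 i
    obtain ⟨c', hc', hcj, -, -⟩ := ht h0 j
    rw [command_eq_unseen hη hηr hD hmem] at hci hhi hcj
    refine ⟨c, hc.1, _, hci, hhi,
      ((Complex.reCLM.hasFDerivAt.comp_hasDerivAt t hci).sub
        (Complex.reCLM.hasFDerivAt.comp_hasDerivAt t hcj)).const_mul _, ?_⟩
    have h1 := (heading_coordinates (hmem i).2.le).1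
    have h2 := (heading_coordinates (hmem j).2.le).1
    rw [hj, side_partner, ← hj] at h2
    simp only [Complex.reCLM_apply, Complex.re_ofReal_mul]
    have h3 : V * c * (9 / 10) ≤ V * c * (side i * (heading (x t i)).re) :=
      mul_le_mul_of_nonneg_left (by linarith) (mul_nonneg hVpos.le hc.1)
    have h4 : 0 ≤ V * c' * (-side i * (heading (x t j)).re) :=
      mul_nonneg (mul_nonneg hVpos.le hc'.1) (by linarith)
    rw [hV] at h3 h4 ⊢
    linarith
  have hdisp : ‖(x T i).1 - (x 0 i).1‖ ≤ 10 / 9 * (φ 0 - φ T) := by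
    refine norm_sub_le_of_dissipation (G := fun t => (x t i).1) hT.le (hac i T hT.le) hφac ?_
    filter_upwards [key] with t ht h0 hTt
    obtain ⟨c, hc, e, h1, -, h3, h4⟩ := ht h0 hTt
    refine ⟨_, e, h1, h3, le_trans (le_of_eq ?_) h4⟩
    rw [norm_mul, norm_heading, Complex.norm_real, Real.norm_eq_abs, abs_mul, abs_of_nonneg hc,
      abs_of_neg hv, hV]
    ring
  have hturn : ‖heading (x T i) - heading (x 0 i)‖ ≤
      |B.turnRate u.unseen| / V * (10 / 9) * (φ 0 - φ T) := by
    refine norm_sub_le_of_dissipation (G := fun t => heading (x t i)) hT.le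
      (hx.ac_heading i T hT.le) hφac ?_
    filter_upwards [key] with t ht h0 hTt
    obtain ⟨c, hc, e, -, h2, h3, h4⟩ := ht h0 hTt
    refine ⟨_, e, h2, h3, ?_⟩
    have h5 := mul_le_mul_of_nonneg_left h4
      (div_nonneg (abs_nonneg (B.turnRate u.unseen)) hVpos.le)
    rw [norm_mul, norm_mul, norm_heading, Complex.norm_real, Complex.norm_I, Real.norm_eq_abs,
      abs_mul, abs_of_nonneg hc]
    have h6 : |B.turnRate u.unseen| / V * (V * c) = |B.turnRate u.unseen| * c := by
      field_simp
    linarith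
  rw [hx.init] at hdisp hturn
  -- Hence the displacement is at most 70/9 η, which together with the initial error `η` stays below
  -- `10 * η`.
  have hdrop : φ 0 - φ T ≤ 7 * η := by linarith
  have hw : |B.turnRate u.unseen| / V * (10 / 9) * (φ 0 - φ T) ≤ 1 / 100 := by
    have h1 : |B.turnRate u.unseen| / V * η ≤ 1 / 1000 := by
      rw [div_mul_eq_mul_div, div_le_iff₀ hVpos]; linarith
    have h2 := mul_le_mul_of_nonneg_left hdrop
      (div_nonneg (abs_nonneg (B.turnRate u.unseen)) hVpos.le)
    linarith
  constructor
  · have := norm_sub_le_norm_sub_add_norm_sub (x T i).1 (x₀ i).1 (anchor z B.r η D i)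
    linarith [(hx₀ i).1]
  · have := norm_sub_le_norm_sub_add_norm_sub (heading (x T i)) (heading (x₀ i)) (side i : ℂ)
    linarith [(hx₀ i).2]

/-- All trajectories from states that are back to back stay back to back. -/
lemma IsTrajectory.mem_backToBack {x₀ : State n} {x : ℝ → State n} (hn : Even n) (hη : 0 < η)
    (hηr : 1000 * η ≤ B.r) (hη1 : 1000 * η ≤ 1) (hv : B.speed u.unseen < 0)
    (hηw : 1000 * (|B.turnRate u.unseen| * η) ≤ -B.speed u.unseen) (hD : 10 * B.r ≤ D)
    (hx₀ : x₀ ∈ backToBack n z B.r η D η η) (hx : IsTrajectory B u x₀ x) {t : ℝ} (ht : 0 ≤ t) :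
    x t ∈ backToBack n z B.r η D (10 * η) (1 / 10) := by
  set Ω := backToBack n z B.r η D (10 * η) (1 / 10)
  by_contra hxt
  set A : Set ℝ := {s ∈ Icc 0 t | x s ∉ Ω} with hA
  have hAeq : A = ⋃ i : Fin n,
      {s ∈ Icc 0 t | 10 * η ≤ ‖(x s i).1 - anchor z B.r η D i‖} ∪
        {s ∈ Icc 0 t | 1 / 10 ≤ ‖heading (x s i) - (side i : ℂ)‖} := by
    ext s
    simp only [hA, Ω, backToBack, mem_ofPred_eq, mem_iUnion, mem_union, not_forall, not_and_or,
      not_lt, ← and_or_left, exists_and_left]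
  have hclosed : IsClosed A := by
    rw [hAeq]
    refine isClosed_iUnion_of_finite fun i => IsClosed.union ?_ ?_
    · have h := (hx.ac_center i t ht).continuousOn
      rw [uIcc_of_le ht] at h
      exact isClosed_Icc.isClosed_le continuousOn_const (h.sub continuousOn_const).norm
    · have h := (hx.ac_heading i t ht).continuousOn
      rw [uIcc_of_le ht] at h
      exact isClosed_Icc.isClosed_le continuousOn_const (h.sub continuousOn_const).norm
  -- Closedness of `A` provides a first exit time `T`, to which the bootstrap step applies.
  obtain ⟨T, ⟨hTmem, hT⟩, hleast⟩ := (isCompact_Icc.of_isClosed_subset hclosed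
    fun _ h => h.1).exists_isLeast ⟨t, right_mem_Icc.2 ht, hxt⟩
  rcases hTmem.1.eq_or_lt with h | h
  · rw [← h, hx.init] at hT
    exact hT (backToBack_subset_backToBack (by linarith) (by linarith) hx₀)
  · refine hT (mem_backToBack_of_forall_before hn hη hηr hη1 hv hηw hD hx₀ hx h fun s hs => ?_)
    by_contra hxs
    exact hs.2.not_ge (hleast ⟨⟨hs.1, hs.2.le.trans hTmem.2⟩, hxs⟩)

/-! ### Existence of a trajectory -/

/-- The motion of a single robot with speed `v` and turn rate `w`. -/
def arc (v w : ℝ) (p : Pose) (t : ℝ) : Pose :=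
  (p.1 + v * heading p * ((Complex.exp (Complex.I * (w * t : ℝ)) - 1) / (Complex.I * w)),
    p.2 + ((w * t : ℝ) : AddCircle (2 * Real.pi)))

variable {v w : ℝ} {p : Pose}

lemma arc_zero : arc v w p 0 = p := by
  ext <;> simp [arc]

lemma heading_arc (t : ℝ) : heading (arc v w p t) =
    heading p * Complex.exp (Complex.I * (w * t : ℝ)) := by
  rw [heading, arc, AddCircle.toCircle_add, AddCircle.toCircle_apply_mk,
    div_self Real.two_pi_pos.ne', one_mul, Circle.coe_mul, Circle.coe_exp, mul_comm Complex.I]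
  rfl

lemma hasDerivAt_exp_I_mul (t : ℝ) :
    HasDerivAt (fun s : ℝ => Complex.exp (Complex.I * (w * s : ℝ)))
      (Complex.exp (Complex.I * (w * t : ℝ)) * (Complex.I * w)) t := by
  have h : HasDerivAt (fun s : ℝ => Complex.I * (w * s : ℝ)) (Complex.I * w) t := by
    have := ((hasDerivAt_id t).const_mul w).ofReal_comp.const_mul Complex.I
    simpa using this
  exact h.cexp

lemma hasDerivAt_heading_arc (t : ℝ) : HasDerivAt (fun s => heading (arc v w p s))
    ((w : ℂ) * Complex.I * heading (arc v w p t)) t := by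
  simp only [heading_arc]
  exact ((hasDerivAt_exp_I_mul (w := w) t).const_mul (heading p)).congr_deriv (by ring)

lemma hasDerivAt_arc_fst (hw : w ≠ 0) (t : ℝ) : HasDerivAt (fun s => (arc v w p s).1)
    ((v : ℂ) * heading (arc v w p t)) t := by
  rw [heading_arc]
  have hw' : (w : ℂ) ≠ 0 := Complex.ofReal_ne_zero.2 hw
  refine ((((hasDerivAt_exp_I_mul (w := w) t).sub_const 1).div_const
    (Complex.I * w)).const_mul ((v : ℂ) * heading p) |>.const_add p.1).congr_deriv ?_
  field_simp [Complex.I_ne_zero]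

lemma lipschitzWith_of_hasDerivAt {f f' : ℝ → ℂ} {C : ℝ} (hf : ∀ t, HasDerivAt f (f' t) t)
    (h : ∀ t, ‖f' t‖ ≤ C) : LipschitzWith C.toNNReal f := by
  have hC : 0 ≤ C := (norm_nonneg _).trans (h 0)
  refine lipschitzWith_of_nnnorm_deriv_le (fun t => (hf t).differentiableAt) fun t => ?_
  rw [← NNReal.coe_le_coe, coe_nnnorm, (hf t).deriv, Real.coe_toNNReal _ hC]
  exact h t

lemma lipschitzWith_arc_fst (hw : w ≠ 0) :
    LipschitzWith (|v|).toNNReal fun s => (arc v w p s).1 :=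
  lipschitzWith_of_hasDerivAt (hasDerivAt_arc_fst hw) fun t => by simp [norm_heading]

lemma lipschitzWith_heading_arc : LipschitzWith (|w|).toNNReal fun s => heading (arc v w p s) :=
  lipschitzWith_of_hasDerivAt hasDerivAt_heading_arc fun t => by simp [norm_heading]

lemma norm_heading_arc_sub_le {t : ℝ} (ht : 0 ≤ t) :
    ‖heading (arc v w p t) - heading p‖ ≤ |w| * t := by
  have h := (lipschitzWith_heading_arc (v := v) (w := w) (p := p)).dist_le_mul t 0
  simpa [arc_zero, dist_eq_norm, abs_of_nonneg ht] using h

/-- A robot that looks approximately in direction `a` moves approximately straight. -/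
lemma norm_arc_fst_sub_le (hw : w ≠ 0) {a : ℂ} {T δ : ℝ}
    (h : ∀ t ∈ Icc 0 T, ‖heading (arc v w p t) - a‖ ≤ δ) {t : ℝ} (ht : t ∈ Icc 0 T) :
    ‖(arc v w p t).1 - p.1 - v * a * t‖ ≤ |v| * δ * t := by
  have hd : ∀ s ∈ Icc 0 T, HasDerivWithinAt (fun s : ℝ => (arc v w p s).1 - v * a * s)
      ((v : ℂ) * (heading (arc v w p s) - a)) (Icc 0 T) s := fun s _ => by
    refine (((hasDerivAt_arc_fst hw s).sub
      ((hasDerivAt_id s).ofReal_comp.const_mul ((v : ℂ) * a))).congr_deriv ?_).hasDerivWithinAt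
    simp; ring
  have := norm_image_sub_le_of_norm_deriv_le_segment' hd (C := |v| * δ) (fun s hs => by
    rw [norm_mul, Complex.norm_real, Real.norm_eq_abs]
    exact mul_le_mul_of_nonneg_left (h s (Ico_subset_Icc_self hs)) (abs_nonneg v)) t ht
  simp only [arc_zero, Complex.ofReal_zero, mul_zero, sub_zero] at this
  rwa [sub_right_comm] at this

lemma anchor_sub_anchor_partner {r : ℝ} (i : Fin n) :
    anchor z r η D i - anchor z r η D (partner hn i) = side i * (2 * (r + 2 * η) : ℝ) := by
  apply Complex.ext
  · simp only [anchor, side_partner, Complex.sub_re, Complex.re_ofReal_mul, Complex.ofReal_re]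
    ring
  · simp only [anchor, partner_div_two, Complex.sub_im, Complex.im_ofReal_mul, Complex.ofReal_im]
    ring

/-- Backing up means moving towards the partner: in the inner product, the horizontal term of size
at least `9 / 10 * (2 * r - η)` dominates the vertical one of at most `2 * η`. This is what permits
a robot to halt. -/
lemma obstructed_of_mem_backToBack {x : State n} (hη : 0 < η) (hηr : 1000 * η ≤ B.r)
    (hv : B.speed u.unseen < 0) (hD : 10 * B.r ≤ D)
    (hx : x ∈ backToBack n z B.r η D (10 * η) (1 / 10)) {i : Fin n}
    (hi : dist (x i).1 (x (partner hn i)).1 = 2 * B.r) : Obstructed B u x i := by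
  refine ⟨partner hn i, partner_ne i, hi, ?_⟩
  rw [command_eq_unseen hη hηr hD hx]
  refine mul_pos_of_neg_of_neg hv ?_
  obtain ⟨h1, h2⟩ := heading_coordinates (hx i).2.le
  have h3 := le_horizontal_separation hη hηr (hx i).1.le (hx (partner hn i)).1.le hi.ge
  have h4 := (center_coordinates (hx i).1.le).2
  have h5 := (center_coordinates (hx (partner hn i)).1.le).2
  rw [partner_div_two] at h5
  set a := (x i).1
  set b := (x (partner hn i)).1
  set h := heading (x i)
  have h6 : |b.im - a.im| ≤ 20 * η := by
    rw [abs_le] at h4 h5 ⊢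
    constructor <;> linarith
  have h7 : |h.im * (b.im - a.im)| ≤ 1 / 10 * (20 * η) := by
    rw [abs_mul]
    exact mul_le_mul h2 h6 (abs_nonneg _) (by norm_num)
  have h8 : inner ℝ h (b - a) = h.re * (b.re - a.re) + h.im * (b.im - a.im) := by
    rw [Complex.inner, Complex.mul_re, Complex.conj_re, Complex.conj_im, Complex.sub_re,
      Complex.sub_im]
    ring
  have h9 : h.re * (b.re - a.re) = -(side i * h.re * (side i * (a.re - b.re))) := by
    rcases side_eq i with hs | hs <;> rw [hs] <;> ring
  have h10 : 9 / 10 * (2 * B.r - η) ≤ side i * h.re * (side i * (a.re - b.re)) :=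
    mul_le_mul (by linarith) h3 (by linarith) (by linarith)
  rw [h8, h9]
  linarith [(abs_le.1 h7).2]

variable {x₀ : State n}

/-- The horizon `5 * η / -v` is the time in which a robot backs up by `5 * η`, enough to close the
gap to its partner. The turning meanwhile is at most `5 / 1000`. -/
lemma norm_heading_arc_sub_side_le (hη : 0 < η) (hη1 : 1000 * η ≤ 1) (hv : v < 0)
    (hηw : 1000 * (|w| * η) ≤ -v) {r : ℝ} (hx₀ : x₀ ∈ backToBack n z r η D η η) (i : Fin n)
    {t : ℝ} (ht : t ∈ Icc 0 (5 * η / -v)) :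
    ‖heading (arc v w (x₀ i) t) - (side i : ℂ)‖ ≤ 1 / 100 := by
  have h1 := norm_sub_le_norm_sub_add_norm_sub (heading (arc v w (x₀ i) t)) (heading (x₀ i))
    (side i : ℂ)
  have h2 := norm_heading_arc_sub_le (v := v) (w := w) (p := x₀ i) ht.1
  have h3 : |w| * t ≤ 5 / 1000 := by
    refine (mul_le_mul_of_nonneg_left ht.2 (abs_nonneg w)).trans ?_
    rw [← mul_div_assoc, div_le_iff₀ (by linarith)]
    linarith
  linarith [(hx₀ i).2]

lemma norm_arc_fst_sub_line_le (hη : 0 < η) (hη1 : 1000 * η ≤ 1) (hv : v < 0) (hw : w ≠ 0)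
    (hηw : 1000 * (|w| * η) ≤ -v) {r : ℝ} (hx₀ : x₀ ∈ backToBack n z r η D η η) (i : Fin n)
    {t : ℝ} (ht : t ∈ Icc 0 (5 * η / -v)) :
    ‖(arc v w (x₀ i) t).1 - (x₀ i).1 - v * side i * t‖ ≤ η / 20 := by
  refine (norm_arc_fst_sub_le hw (fun s hs =>
    norm_heading_arc_sub_side_le hη hη1 hv hηw hx₀ i hs) ht).trans ?_
  have h := mul_le_mul_of_nonneg_left ht.2 (by linarith : 0 ≤ -v)
  rw [mul_div_cancel₀ _ (by linarith)] at h
  rw [abs_of_neg hv]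
  linarith

lemma norm_arc_fst_sub_anchor_lt (hη : 0 < η) (hη1 : 1000 * η ≤ 1) (hv : v < 0) (hw : w ≠ 0)
    (hηw : 1000 * (|w| * η) ≤ -v) {r : ℝ} (hx₀ : x₀ ∈ backToBack n z r η D η η) (i : Fin n)
    {t : ℝ} (ht : t ∈ Icc 0 (5 * η / -v)) :
    ‖(arc v w (x₀ i) t).1 - anchor z r η D i‖ < 10 * η := by
  have h1 := norm_arc_fst_sub_line_le hη hη1 hv hw hηw hx₀ i ht
  have h2 : ‖(v * side i * t : ℂ)‖ ≤ 5 * η := by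
    have h := mul_le_mul_of_nonneg_left ht.2 (by linarith : 0 ≤ -v)
    rw [mul_div_cancel₀ _ (by linarith)] at h
    have h3 : ‖(side i : ℂ)‖ = 1 := by
      rcases side_eq i with hs | hs <;> simp [hs]
    rwa [norm_mul, norm_mul, h3, Complex.norm_real, Complex.norm_real, Real.norm_eq_abs,
      Real.norm_eq_abs, abs_of_neg hv, abs_of_nonneg ht.1, mul_one]
  calc ‖(arc v w (x₀ i) t).1 - anchor z r η D i‖
      = ‖((arc v w (x₀ i) t).1 - (x₀ i).1 - v * side i * t) + v * side i * t +
          ((x₀ i).1 - anchor z r η D i)‖ := by congr 1; ring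
    _ ≤ _ := norm_add₃_le
    _ < 10 * η := by linarith [(hx₀ i).1]

lemma dist_arc_partner_le {r : ℝ} (hη : 0 < η) (hηr : 1000 * η ≤ r) (hη1 : 1000 * η ≤ 1)
    (hv : v < 0) (hw : w ≠ 0)
    (hηw : 1000 * (|w| * η) ≤ -v) (hx₀ : x₀ ∈ backToBack n z r η D η η) (i : Fin n) :
    dist (arc v w (x₀ i) (5 * η / -v)).1 (arc v w (x₀ (partner hn i)) (5 * η / -v)).1
      ≤ 2 * r := by
  have hv' : (v : ℂ) ≠ 0 := Complex.ofReal_ne_zero.2 hv.ne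
  have hT : 5 * η / -v ∈ Icc 0 (5 * η / -v) :=
    right_mem_Icc.2 (div_nonneg (by linarith) (by linarith))
  have h1 := norm_arc_fst_sub_line_le hη hη1 hv hw hηw hx₀ i hT
  have h2 := norm_arc_fst_sub_line_le hη hη1 hv hw hηw hx₀ (partner hn i) hT
  have hi := (hx₀ i).1
  have hj := (hx₀ (partner hn i)).1
  have h3 := anchor_sub_anchor_partner (hn := hn) (z := z) (η := η) (D := D) (r := r) i
  rw [side_partner] at h2
  have hvT : (v : ℂ) * ((5 * η / -v : ℝ) : ℂ) = -(5 * η) := by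
    push_cast; field_simp
  rw [mul_right_comm, hvT] at h1 h2
  -- The anchors are `2 * (r + 2 * η)` apart, and each robot backs up by `5 * η` along the ideal
  -- line; the remaining slack `6 * η` absorbs all errors.
  have h4 : ‖(side i * (2 * (r - 3 * η) : ℝ) : ℂ)‖ = 2 * (r - 3 * η) := by
    have h3 : ‖(side i : ℂ)‖ = 1 := by
      rcases side_eq i with hs | hs <;> simp [hs]
    rw [norm_mul, h3, one_mul, Complex.norm_real, Real.norm_eq_abs, abs_of_nonneg (by linarith)]
  set X := (arc v w (x₀ i) (5 * η / -v)).1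
  set Y := (arc v w (x₀ (partner hn i)) (5 * η / -v)).1
  rw [dist_eq_norm]
  calc ‖X - Y‖ = ‖((X - (x₀ i).1 - -(5 * η) * side i) -
        (Y - (x₀ (partner hn i)).1 - -(5 * η) * (-side i : ℝ))) +
        (((x₀ i).1 - anchor z r η D i) -
          ((x₀ (partner hn i)).1 - anchor z r η D (partner hn i))) +
        side i * (2 * (r - 3 * η) : ℝ)‖ := by
        congr 1
        push_cast at h3 ⊢
        linear_combination h3
    _ ≤ (η / 20 + η / 20) + (η + η) + 2 * (r - 3 * η) := by
        refine norm_add₃_le.trans (add_le_add (add_le_add ?_ ?_) h4.le)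
        · exact (norm_sub_le _ _).trans (add_le_add h1 h2)
        · exact (norm_sub_le _ _).trans (add_le_add hi.le hj.le)
    _ ≤ 2 * r := by linarith

/-- The distance of a robot from its partner as long as both move freely. -/
def separation (hn : Even n) (v w : ℝ) (x₀ : State n) (i : Fin n) (t : ℝ) : ℝ :=
  dist (arc v w (x₀ i) t).1 (arc v w (x₀ (partner hn i)) t).1

lemma separation_partner (i : Fin n) :
    separation hn v w x₀ (partner hn i) = separation hn v w x₀ i := by
  ext t
  rw [separation, separation, partner_partner, dist_comm]

lemma continuous_separation (hw : w ≠ 0) (i : Fin n) :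
    Continuous (separation hn v w x₀ i) :=
  (lipschitzWith_arc_fst hw).continuous.dist (lipschitzWith_arc_fst hw).continuous

/-- The first time at which a robot touches its partner. -/
def contactTime (hn : Even n) (v w : ℝ) (x₀ : State n) (r : ℝ) (i : Fin n) : ℝ :=
  sInf {t | 0 ≤ t ∧ separation hn v w x₀ i t = 2 * r}

lemma contactTime_partner {r : ℝ} (i : Fin n) :
    contactTime hn v w x₀ r (partner hn i) = contactTime hn v w x₀ r i := by
  simp only [contactTime, separation_partner]

/-- By the intermediate value theorem contact occurs by time `T`, so the `sInf` is over a nonempty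
closed set; an overlap before the first contact would force a still earlier one. -/
lemma contactTime_spec {r T : ℝ} (hw : w ≠ 0) (hT : 0 ≤ T) {i : Fin n}
    (h0 : 2 * r ≤ separation hn v w x₀ i 0) (h1 : separation hn v w x₀ i T ≤ 2 * r) :
    contactTime hn v w x₀ r i ∈ Icc 0 T ∧
      separation hn v w x₀ i (contactTime hn v w x₀ r i) = 2 * r ∧
      ∀ t ∈ Icc 0 (contactTime hn v w x₀ r i), 2 * r ≤ separation hn v w x₀ i t := by
  set S := {t | 0 ≤ t ∧ separation hn v w x₀ i t = 2 * r} with hS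
  have hcont := continuous_separation (hn := hn) (v := v) (x₀ := x₀) hw i
  have hclosed : IsClosed S :=
    isClosed_Ici.inter (isClosed_singleton.preimage hcont)
  have hbdd : BddBelow S := ⟨0, fun _ h => h.1⟩
  have hivt : ∀ t, 0 ≤ t → separation hn v w x₀ i t ≤ 2 * r → ∃ s ∈ S, s ≤ t := by
    intro t ht h
    obtain ⟨s, hs, hs'⟩ := intermediate_value_Icc' ht hcont.continuousOn ⟨h, h0⟩
    exact ⟨s, ⟨hs.1, hs'⟩, hs.2⟩
  obtain ⟨s, hs, hsT⟩ := hivt T hT h1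
  have hmem : contactTime hn v w x₀ r i ∈ S := hclosed.csInf_mem ⟨s, hs⟩ hbdd
  refine ⟨⟨hmem.1, (csInf_le hbdd hs).trans hsT⟩, hmem.2, fun t ht => ?_⟩
  by_contra! hlt
  obtain ⟨s, hs, hst⟩ := hivt t ht.1 hlt.le
  have : s = t := le_antisymm hst (ht.2.trans (csInf_le hbdd hs))
  rw [this] at hs
  exact hlt.ne hs.2

/-- Each robot moves on a circular arc until it touches its partner, and then stands still. -/
def haltingMotion (hn : Even n) (v w : ℝ) (x₀ : State n) (r : ℝ) (t : ℝ) : State n :=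
  fun i => arc v w (x₀ i) (min t (contactTime hn v w x₀ r i))

/-- Only partners can touch, and they share their contact time. The executed fraction is 1 before it
and 0 after it, where the robot is obstructed. -/
lemma isTrajectory_haltingMotion (hη : 0 < η) (hηr : 1000 * η ≤ B.r) (hη1 : 1000 * η ≤ 1)
    (hv : B.speed u.unseen < 0) (hw : B.turnRate u.unseen ≠ 0)
    (hηw : 1000 * (|B.turnRate u.unseen| * η) ≤ -B.speed u.unseen) (hD : 10 * B.r ≤ D)
    (hx₀ : x₀ ∈ backToBack n z B.r η D η η) :
    IsTrajectory B u x₀ (haltingMotion hn (B.speed u.unseen) (B.turnRate u.unseen) x₀ B.r) := by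
  set v := B.speed u.unseen
  set w := B.turnRate u.unseen
  set τ := contactTime hn v w x₀ B.r
  set y := haltingMotion hn v w x₀ B.r
  have hfree := backToBack_subset_freeStates hη hηr hD hx₀
  have hτ : ∀ i, τ i ∈ Icc 0 (5 * η / -v) ∧ separation hn v w x₀ i (τ i) = 2 * B.r ∧
      ∀ t ∈ Icc 0 (τ i), 2 * B.r ≤ separation hn v w x₀ i t := fun i => by
    refine contactTime_spec hw (div_nonneg (by linarith) (by linarith)) ?_
      (dist_arc_partner_le hη hηr hη1 hv hw hηw hx₀ i)
    simpa only [separation, arc_zero] using hfree i _ (partner_ne i).symm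
  have hmin : ∀ i t, 0 ≤ t → min t (τ i) ∈ Icc 0 (τ i) := fun i t ht =>
    ⟨le_min ht (hτ i).1.1, min_le_right _ _⟩
  have hy : ∀ t, 0 ≤ t → y t ∈ backToBack n z B.r η D (10 * η) (1 / 10) := fun t ht i => by
    have hmem : min t (τ i) ∈ Icc 0 (5 * η / -v) :=
      ⟨(hmin i t ht).1, (hmin i t ht).2.trans (hτ i).1.2⟩
    exact ⟨norm_arc_fst_sub_anchor_lt hη hη1 hv hw hηw hx₀ i hmem,
      (norm_heading_arc_sub_side_le hη hη1 hv hηw hx₀ i hmem).trans_lt (by norm_num)⟩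
  have hdist : ∀ i t, dist (y t i).1 (y t (partner hn i)).1 =
      separation hn v w x₀ i (min t (τ i)) := fun i t => by
    simp only [y, haltingMotion, contactTime_partner, separation, τ]
  refine ⟨?_, ?_, ?_, ?_, ?_⟩
  · funext i
    simp only [y, haltingMotion]
    rw [min_eq_left (hτ i).1.1, arc_zero]
  · intro t ht i j hij
    by_cases h : j.1 / 2 = i.1 / 2
    · rw [eq_partner_of_div_two_eq (hn := hn) hij.symm h, hdist]
      exact (hτ i).2.2 _ (hmin i t ht)
    · exact (two_mul_lt_dist_of_div_two_ne hη hηr hD (hy t ht) (Ne.symm h)).le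
  · intro i T _
    exact ((lipschitzWith_arc_fst hw).comp
      (LipschitzWith.id.min_const (τ i))).lipschitzOnWith.absolutelyContinuousOnInterval
  · intro i T _
    exact (lipschitzWith_heading_arc.comp
      (LipschitzWith.id.min_const (τ i))).lipschitzOnWith.absolutelyContinuousOnInterval
  -- The motion may fail to be differentiable at the contact times, which are finitely many.
  · have hne : (range τ)ᶜ ∈ ae volume :=
      compl_mem_ae_iff.2 (Set.Finite.measure_zero (Set.finite_range τ) _)
    filter_upwards [hne] with t ht h0 i
    rw [command_eq_unseen hη hηr hD (hy t h0.le)]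
    rcases lt_or_gt_of_ne (fun h => ht ⟨i, h.symm⟩ : t ≠ τ i) with h | h
    · have hev : (fun s => y s i) =ᶠ[nhds t] fun s => arc v w (x₀ i) s := by
        filter_upwards [Iio_mem_nhds h] with s hs
        simp only [y, haltingMotion]
        rw [min_eq_left (le_of_lt hs)]
      refine ⟨1, ⟨zero_le_one, le_rfl⟩, ?_, ?_, fun h => absurd rfl h⟩
      · rw [one_mul, show y t i = arc v w (x₀ i) t from hev.self_of_nhds]
        exact (hasDerivAt_arc_fst hw t).congr_of_eventuallyEq (hev.fun_comp Prod.fst)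
      · rw [one_mul, show y t i = arc v w (x₀ i) t from hev.self_of_nhds]
        exact (hasDerivAt_heading_arc t).congr_of_eventuallyEq (hev.fun_comp heading)
    · have hev : (fun s => y s i) =ᶠ[nhds t] fun _ => arc v w (x₀ i) (τ i) := by
        filter_upwards [Ioi_mem_nhds h] with s hs
        simp only [y, haltingMotion]
        rw [min_eq_right (le_of_lt hs)]
      refine ⟨0, ⟨le_rfl, zero_le_one⟩, ?_, ?_, fun _ => ?_⟩
      · simp only [zero_mul, Complex.ofReal_zero]
        exact (hasDerivAt_const t _).congr_of_eventuallyEq (hev.fun_comp Prod.fst)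
      · simp only [zero_mul, Complex.ofReal_zero]
        exact (hasDerivAt_const t _).congr_of_eventuallyEq (hev.fun_comp heading)
      · refine obstructed_of_mem_backToBack (hn := hn) hη hηr hv hD (hy t h0.le) ?_
        rw [hdist, min_eq_right h.le, (hτ i).2.1]

lemma backToBack_subset_nonaggregating {ρ : ℝ} (hn : Even n) (h4 : 4 ≤ n) (hη : 0 < η)
    (hηr : 1000 * η ≤ B.r) (hη1 : 1000 * η ≤ 1)
    (hv : B.speed u.unseen < 0) (hw : B.turnRate u.unseen ≠ 0)
    (hηw : 1000 * (|B.turnRate u.unseen| * η) ≤ -B.speed u.unseen) (hρ : 0 ≤ ρ) :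
    backToBack n z B.r η (10 * (B.r + ρ)) η η ⊆ nonaggregating B ρ u n := by
  have hD : 10 * B.r ≤ 10 * (B.r + ρ) := by linarith
  refine fun x₀ hx₀ => ⟨⟨_, isTrajectory_haltingMotion (hn := hn) hη hηr hη1 hv hw hηw hD hx₀⟩,
    fun x hx t ht => ?_⟩
  exact notMem_aggregatedStates hη hηr hρ rfl h4
    (hx.mem_backToBack hn hη hηr hη1 hv hηw hD hx₀ ht)

/-! ### Mode A and the choice of the constants -/

lemma speed_neg {c : Wheels} (hc : c.IsCircularBackwards) : B.speed c < 0 := by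
  have := mul_neg_of_pos_of_neg B.vmax_pos hc.1
  have := mul_neg_of_pos_of_neg B.vmax_pos hc.2.1
  unfold Body.speed
  linarith

lemma turnRate_ne_zero {c : Wheels} (hc : c.IsCircularBackwards) : B.turnRate c ≠ 0 := by
  refine div_ne_zero ?_ B.axle_pos.ne'
  rw [← mul_sub]
  exact mul_ne_zero B.vmax_pos.ne' (sub_ne_zero.2 hc.2.2.symm)

lemma exists_small {r a b : ℝ} (hr : 0 < r) (ha : 0 < a) :
    ∃ η, 0 < η ∧ 1000 * η ≤ r ∧ 1000 * η ≤ 1 ∧ 1000 * (|b| * η) ≤ a := by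
  have hb := abs_nonneg b
  have hab : 0 < a / (|b| + 1) := by positivity
  -- The summand 1 in the denominator keeps it positive even if `b = 0`.
  refine ⟨min r (min 1 (a / (|b| + 1))) / 1000, by positivity, ?_, ?_, ?_⟩
  · linarith [min_le_left r (min 1 (a / (|b| + 1)))]
  · linarith [min_le_right r (min 1 (a / (|b| + 1))), min_le_left 1 (a / (|b| + 1))]
  · have h : min r (min 1 (a / (|b| + 1))) ≤ a / (|b| + 1) :=
      (min_le_right _ _).trans (min_le_right _ _)
    have h1 := mul_le_mul_of_nonneg_left h hb
    have h2 : |b| * (a / (|b| + 1)) ≤ a := by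
      rw [← mul_div_assoc, div_le_iff₀ (by linarith)]
      nlinarith
    linarith

end Swarm

end

theorem theorem2 (B : Swarm.Body) (u : Swarm.Controller)
    (hA : u.unseen.IsCircularBackwards) (hR : 1.707 * B.r < B.turnRadius u.unseen)
    (ρ : ℝ) (hρ : 0 ≤ ρ) (n : ℕ) (hn : 4 ≤ n) (heven : Even n) :
    ∃ L : ℝ, 0 < L ∧ ∀ W : Set ℂ, MeasurableSet W → volume W ≠ ∞ →
      (∃ z, Metric.closedBall z L ⊆ W) →
      ∃ N : Set (Swarm.State n), MeasurableSet N ∧ N ⊆ Swarm.nonaggregating B ρ u n ∧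
        0 < Swarm.uniformLaw B.r W n N := by
  have hv := Swarm.speed_neg (B := B) hA
  have hw := Swarm.turnRate_ne_zero (B := B) hA
  have hr := B.r_pos
  obtain ⟨η, hη, hηr, hη1, hηw⟩ :=
    Swarm.exists_small (b := B.turnRate u.unseen) hr (neg_pos.2 hv)
  -- A disc of this radius contains all centers of the stack, with spacing `10 * (B.r + ρ)`.
  refine ⟨2 * B.r + n * (10 * (B.r + ρ)), by positivity, fun W _ hWfin ⟨z, hz⟩ => ?_⟩
  have hopen : IsOpen (Swarm.backToBack n z B.r η (10 * (B.r + ρ)) η η) :=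
    Swarm.isOpen_backToBack
  exact ⟨_, hopen.measurableSet,
    Swarm.backToBack_subset_nonaggregating heven hn hη hηr hη1 hv hw hηw hρ,
    Swarm.uniformLaw_pos hWfin hopen (Swarm.backToBack_nonempty hη hη)
      (Swarm.backToBack_subset_initialStates hη hηr (by linarith) le_rfl hz)⟩
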